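/- Let $r>0$ and $q=e^{-\pi\sqrt r}$. Let $K(x)=\frac{\pi}{2}\,{}_2F_1\left(\frac12,\frac12;1;x^2\right)$, let $k_r\in(0,1)$ be the solution of $K\left(\sqrt{1-k_r^2}\right)/K(k_r)=\sqrt r$, and put $K=K(k_r)$. On the strip $S=\{u\in\mathbb C: |q^{1/2}e^{i\pi u/(2K)}|<1,\ |q^{1/2}e^{-i\pi u/(2K)}|<1\}$ consider the series $$\mathrm{cd}(q,u)=\frac{2\pi}{Kk_r}\sum_{n=0}^\infty\frac{(-1)^nq^{n+1/2}\cos\left((2n+1)\frac{\pi u}{2K}\right)}{1-q^{2n+1}},\qquad \mathrm{cd}_1(q,u)=\frac{2\pi}{Kk_r}\sum_{n=0}^\infty\frac{(-1)^nq^{n+1/2}\cos\left((2n+3)\frac{\pi u}{2K}\right)}{1-q^{2n+1}}.$$ (The first one is the Fourier series of the Jacobi elliptic function $\mathrm{cd}$.) Let $H=\{u\in\mathbb C:|q^{1/2}e^{i\pi u/(2K)}|<1\}$, a half plane that contains $S$. For $t\in\mathbb C$ put $A=A(t)=iq^{1/2}e^{i\pi t/(2K)}$, and let $(z;q)_\infty=\prod_{n=0}^\infty(1-zq^n)$.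 Then both series converge on $S$; $\mathrm{cd}(q,\cdot)$ continues to a meromorphic function on $\mathbb C$ and $\mathrm{cd}_1(q,\cdot)$ to a meromorphic function on $H$ (denoted by the same symbols). For $t\in H$ the continued fraction $$F(t)=-1+\cfrac{2}{1+\cfrac{-2A}{1-q+\cfrac{A^2(1+q)^2}{1-q^3+\cfrac{A^2q(1+q^2)^2}{1-q^5+\cfrac{A^2q^2(1+q^3)^2}{1-q^7+\cdots}}}}}$$ converges, and $F(t)$ and $G(t)=(-A;q)_\infty/(A;q)_\infty$ are holomorphic functions of $t$ without zeros on $H$. At every $u\in H$ at which $\mathrm{cd}(q,\cdot)$ has no pole, $\mathrm{cd}_1(q,\cdot)$ has no pole either, and $$\mathrm{cd}_1(q,u)=\mathrm{cd}(q,u)\cos\left(\frac{\pi u}{K}\right)-i\,\mathrm{cd}(q,u)\sin\left(\frac{\pi u}{K}\right)-i\,k_r^{-1}\sin\left(\frac{\pi u}{K}\right)\left[\frac{d}{dt}\log F(t)\right]_{t=u},$$ $$\mathrm{cd}_1(q,u)=\mathrm{cd}(q,u)\cos\left(\frac{\pi u}{K}\right)-i\,\mathrm{cd}(q,u)\sin\left(\frac{\pi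 u}{K}\right)-2i\,k_r^{-1}\sin\left(\frac{\pi u}{K}\right)\left[\frac{d}{dt}\log\frac{(-A;q)_\infty}{(A;q)_\infty}\right]_{t=u}.$$ Here $\frac{d}{dt}\log f$ denotes the logarithmic derivative $f'/f$. -/

import Mathlib

open Filter Topology

noncomputable section

namespace EllipticCd

/-- The complete elliptic integral of the first kind as a function of the modulus,
`K(x) = (π / 2) ₂F₁(1/2, 1/2; 1; x²)`. -/
def ellK (x : ℝ) : ℝ :=
  Real.pi / 2 * ordinaryHypergeometric (1 / 2 : ℝ) (1 / 2 : ℝ) (1 : ℝ) (x ^ 2)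

/-- `k` is the singular modulus `k_r`: the solution in `(0, 1)` of `K(√(1 - k²)) / K(k) = √r`. -/
def IsSingularModulus (r k : ℝ) : Prop :=
  0 < k ∧ k < 1 ∧ ellK (√(1 - k ^ 2)) / ellK k = √r

/-- The `n`-th term of the Fourier series of the Jacobi elliptic function `cd(q, u)`, for the
nome `q` and the modulus `k`. -/
def cdTerm (q k : ℝ) (n : ℕ) (u : ℂ) : ℂ :=
  2 * Real.pi / (ellK k * k) *
    ((-1) ^ n * (q ^ ((n : ℝ) + 1 / 2) : ℝ) * Complex.cos ((2 * n + 1) * (Real.pi * u / (2 * ellK k)))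
      / (1 - (q : ℂ) ^ (2 * n + 1)))

/-- The `n`-th term of the trigonometric series that defines `cd₁(q, u)`. -/
def cd1Term (q k : ℝ) (n : ℕ) (u : ℂ) : ℂ :=
  2 * Real.pi / (ellK k * k) *
    ((-1) ^ n * (q ^ ((n : ℝ) + 1 / 2) : ℝ) * Complex.cos ((2 * n + 3) * (Real.pi * u / (2 * ellK k)))
      / (1 - (q : ℂ) ^ (2 * n + 1)))

/-- The half plane of all `u` with `|q^{1/2} e^{iπu/(2K)}| < 1`. -/
def halfPlane (q k : ℝ) : Set ℂ :=
  {u | ‖(√q : ℂ) * Complex.exp (Complex.I * Real.pi * u / (2 * ellK k))‖ < 1}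

/-- The strip `|q^{1/2} e^{± iπu/(2K)}| < 1` around the real axis, on which the series of `cd` and
`cd₁` converge. -/
def strip (q k : ℝ) : Set ℂ :=
  {u | u ∈ halfPlane q k ∧ -u ∈ halfPlane q k}

/-- `g` is the meromorphic continuation to `U` of the sum of the series `∑ aₙ(u)`, which converges
on `S`. The normal form fixes the values of `g`: it is analytic at each point of `U` that is not a
pole, and has the value `0` at each pole. -/
def IsContinuationOfSeries (a : ℕ → ℂ → ℂ) (S U : Set ℂ) (g : ℂ → ℂ) : Prop :=
  MeromorphicNFOn g U ∧ ∀ u ∈ S, HasSum (fun n => a n u) (g u)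

open Classical in
/-- The meromorphic continuation to `U` of the sum of a series that converges on `S`. For a
nonempty open `S` in an open connected `U` its values on `U` are unique if it exists. -/
def continuationOfSeries (a : ℕ → ℂ → ℂ) (S U : Set ℂ) : ℂ → ℂ :=
  if h : ∃ g, IsContinuationOfSeries a S U g then Classical.choose h else 0

/-- The Jacobi elliptic function `cd(q, ·)`, a meromorphic function on `ℂ`: the continuation of
its Fourier series. -/
def cd (q k : ℝ) : ℂ → ℂ :=
  continuationOfSeries (cdTerm q k) (strip q k) Set.univ

/-- The function `cd₁(q, ·)`, continued to the half plane `|q^{1/2} e^{iπu/(2K)}| < 1`. -/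
def cd1 (q k : ℝ) : ℂ → ℂ :=
  continuationOfSeries (cd1Term q k) (strip q k) (halfPlane q k)

/-- The infinite product `(z; q)_∞ = ∏_{n ≥ 0} (1 - z qⁿ)`. -/
def qPoch (z q : ℂ) : ℂ := ∏' n : ℕ, (1 - z * q ^ n)

/-- `A(t) = i q^{1/2} e^{iπt/(2K)}`. -/
def nomeA (q k : ℝ) (t : ℂ) : ℂ :=
  Complex.I * (√q : ℂ) * Complex.exp (Complex.I * Real.pi * t / (2 * ellK k))

/-- The partial numerators and denominators of `ramanujanCF`. -/
def cfPair (q A : ℂ) : ℕ → GenContFract.Pair ℂ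
  | 0 => ⟨2, 1⟩
  | 1 => ⟨-2 * A, 1 - q⟩
  | n + 2 => ⟨A ^ 2 * q ^ n * (1 + q ^ (n + 1)) ^ 2, 1 - q ^ (2 * n + 3)⟩

/-- The continued fraction `-1 + 2/(1 + (-2A)/(1 - q + A²(1+q)²/(1 - q³ + A²q(1+q²)²/(1 - q⁵ +
A²q²(1+q³)²/(1 - q⁷ + ⋯)))))`. -/
def ramanujanCF (q A : ℂ) : GenContFract ℂ :=
  ⟨-1, Stream'.Seq.ofStream (cfPair q A)⟩

/-- The continued fraction `g` converges to `v`: all but finitely many of its convergents have a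
nonzero denominator, and the convergents tend to `v`. -/
def CFConvergesTo (g : GenContFract ℂ) (v : ℂ) : Prop :=
  (∀ᶠ n in atTop, g.dens n ≠ 0) ∧ Tendsto g.convs atTop (𝓝 v)

/-- The value of the continued fraction `ramanujanCF`. -/
def cfValue (q A : ℂ) : ℂ := limUnder atTop (ramanujanCF q A).convs

/-- The quotient `(-A; q)_∞ / (A; q)_∞`. -/
def qPochQuot (q A : ℂ) : ℂ := qPoch (-A) q / qPoch A q

end EllipticCd

end

noncomputable section

namespace EllipticCd

/-! ### The infinite product `(z; q)_∞` -/

/-! Write `Q(z) = (-z; q)_∞ / (z; q)_∞`. Since `A` carries a factor `i`, its odd powers reproduce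
the signs `(-1)ⁿ` of the Fourier series, so the half of `cd` built from `e^{i(2n+1)πu/(2K)}` is a
multiple of the Lambert series `∑ A²ⁿ⁺¹ / (1 - q²ⁿ⁺¹)`. That series equals `(A/2) Q'(A)/Q(A)`
(`hasSum_lambert`) and so converges on all of `H`; the other half is its reflection `u ↦ -u`. In
`cd₁` every angle `a` is shifted by `b = πu/K`. Expanding `cos (a + b)` and replacing `sin a` by `i
cos a - i e^{ia}` leaves only `cd` and the exponential half (`cd1Term_eq`). This proves the second
formula on the strip, and the identity theorem carries it to `H`.

The first formula follows from `F = Q(A)²` (`ramanujanCF_convergesTo`). Heine-type series `fₙ` in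
`A²` solve the recurrence of the continued fraction backwards. Pairing them with the numerators and
denominators gives conserved quantities, so the convergents tend to `(f₀ + 2A f₁) / (f₀ - 2A f₁)`.
Here `f₀` and `2A f₁` are, up to a common factor, the even and odd parts of the q-binomial series
with `a = -1`, whose sum is `Q(A)`; at `-A` it is `1 / Q(A)`.

The q-binomial theorem and the Lambert identity are both proved by invariance under `z ↦ qz` and
continuity at `0`. -/

theorem norm_q_mul_lt {q z : ℂ} (hq : ‖q‖ < 1) (hz : ‖z‖ < 1) : ‖q * z‖ < 1 := by
  rw [norm_mul]
  exact mul_lt_one_of_nonneg_of_lt_one_left (norm_nonneg _) hq hz.le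

theorem one_sub_ne_zero_of_norm_lt {z : ℂ} (hz : ‖z‖ < 1) : 1 - z ≠ 0 := by
  rw [sub_ne_zero]
  rintro rfl
  simp at hz

theorem one_sub_pow_ne_zero {q : ℂ} (hq : ‖q‖ < 1) (n : ℕ) : 1 - q ^ (n + 1) ≠ 0 :=
  one_sub_ne_zero_of_norm_lt (by
    rw [norm_pow]; exact pow_lt_one₀ (norm_nonneg _) hq n.succ_ne_zero)

/-- A function on the unit disc that is invariant under `z ↦ q z` and continuous at `0` is
constant. -/
theorem eq_apply_zero_of_invariant {q : ℂ} (hq : ‖q‖ < 1) {f : ℂ → ℂ} (hf : ContinuousAt f 0)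
    (h : ∀ z, ‖z‖ < 1 → f z = f (q * z)) {z : ℂ} (hz : ‖z‖ < 1) : f z = f 0 := by
  have key : ∀ n : ℕ, ‖q ^ n * z‖ < 1 ∧ f (q ^ n * z) = f z := by
    intro n
    induction n with
    | zero => simpa using hz
    | succ n ih =>
      have e : q ^ (n + 1) * z = q * (q ^ n * z) := by ring
      rw [e]
      exact ⟨norm_q_mul_lt hq ih.1, by rw [← h _ ih.1, ih.2]⟩
  have h0 : Tendsto (fun n : ℕ => q ^ n * z) atTop (𝓝 0) := by
    simpa using (tendsto_pow_atTop_nhds_zero_of_norm_lt_one hq).mul_const z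
  have h1 := hf.tendsto.comp h0
  refine tendsto_nhds_unique (Tendsto.congr (fun n => ?_) tendsto_const_nhds) h1
  exact ((key n).2).symm

theorem summable_norm_mul_pow {q : ℂ} (hq : ‖q‖ < 1) (z : ℂ) :
    Summable fun n : ℕ => ‖-(z * q ^ n)‖ := by
  simpa [norm_mul, norm_pow] using
    (summable_geometric_of_lt_one (norm_nonneg q) hq).mul_left ‖z‖

theorem multipliable_qPoch {q : ℂ} (hq : ‖q‖ < 1) (z : ℂ) :
    Multipliable fun n : ℕ => (1 - z * q ^ n) := by
  simpa [sub_eq_add_neg] using multipliable_one_add_of_summable (summable_norm_mul_pow hq z)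

theorem qPoch_eq_mul {q : ℂ} (hq : ‖q‖ < 1) (z : ℂ) :
    qPoch z q = (1 - z) * qPoch (q * z) q := by
  have e : (fun n : ℕ => 1 - q * z * q ^ n) = fun n : ℕ => 1 - z * q ^ (n + 1) :=
    funext fun n => by ring
  have h := multipliable_qPoch hq (q * z)
  unfold qPoch
  rw [e] at h ⊢
  have h2 := tprod_eq_zero_mul' (f := fun n : ℕ => 1 - z * q ^ n) h
  rw [h2, pow_zero, mul_one]

theorem qPoch_ne_zero {q : ℂ} (hq : ‖q‖ < 1) {z : ℂ} (hz : ‖z‖ < 1) : qPoch z q ≠ 0 := by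
  have := tprod_one_add_ne_zero_of_summable (f := fun n : ℕ => -(z * q ^ n)) (fun n => ?_)
    (summable_norm_mul_pow hq z)
  · simpa [qPoch, sub_eq_add_neg] using this
  · rw [← sub_eq_add_neg]
    refine one_sub_ne_zero_of_norm_lt ?_
    rw [norm_mul, norm_pow]
    exact mul_lt_one_of_nonneg_of_lt_one_left (norm_nonneg _) hz
      (pow_le_one₀ (norm_nonneg _) hq.le)

@[simp] theorem qPoch_zero (q : ℂ) : qPoch 0 q = 1 := by simp [qPoch]

theorem differentiable_qPoch {q : ℂ} (hq : ‖q‖ < 1) : Differentiable ℂ fun z => qPoch z q := by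
  intro z
  have h : HasProdLocallyUniformlyOn (fun (n : ℕ) (w : ℂ) => 1 + -(w * q ^ n))
      (fun w => ∏' n : ℕ, (1 + -(w * q ^ n))) (Metric.ball 0 (‖z‖ + 1)) := by
    refine Summable.hasProdLocallyUniformlyOn_nat_one_add Metric.isOpen_ball
      ((summable_geometric_of_lt_one (norm_nonneg q) hq).mul_left (‖z‖ + 1))
      (.of_forall fun n w hw => ?_) fun n => by fun_prop
    rw [norm_neg, norm_mul, norm_pow]
    have : ‖w‖ < ‖z‖ + 1 := by simpa using hw
    gcongr
  have h2 := h.differentiableOn (.of_forall fun s => by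
    simpa [Finset.prod_fn] using DifferentiableOn.finsetProd (fun _ _ => by fun_prop))
    Metric.isOpen_ball
  have h3 := h2.differentiableAt (Metric.isOpen_ball.mem_nhds (x := z) (by simp))
  simpa [qPoch, sub_eq_add_neg] using h3

theorem qPoch_eq_prod_mul {q : ℂ} (hq : ‖q‖ < 1) (z : ℂ) (n : ℕ) :
    qPoch z q = (∏ i ∈ Finset.range n, (1 - z * q ^ i)) * qPoch (q ^ n * z) q := by
  induction n with
  | zero => simp
  | succ n ih =>
    rw [ih, qPoch_eq_mul hq (q ^ n * z), Finset.prod_range_succ]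
    ring_nf

theorem tendsto_prod_qPoch {q : ℂ} (hq : ‖q‖ < 1) (z : ℂ) :
    Tendsto (fun n => ∏ i ∈ Finset.range n, (1 - z * q ^ i)) atTop (𝓝 (qPoch z q)) :=
  (multipliable_qPoch hq z).hasProd.tendsto_prod_nat

theorem exists_norm_le_of_tendsto {a : ℕ → ℂ} {l : ℂ} (h : Tendsto a atTop (𝓝 l)) :
    ∃ C, ∀ n, ‖a n‖ ≤ C := by
  obtain ⟨C, hC⟩ := h.norm.bddAbove_range
  exact ⟨C, fun n => hC ⟨n, rfl⟩⟩

theorem summable_norm_mul_pow_of_bounded {a : ℕ → ℂ} {C : ℝ} (ha : ∀ n, ‖a n‖ ≤ C) {z : ℂ}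
    (hz : ‖z‖ < 1) : Summable fun n => ‖a n * z ^ n‖ := by
  refine Summable.of_nonneg_of_le (fun _ => norm_nonneg _) (fun n => ?_)
    ((summable_geometric_of_lt_one (norm_nonneg z) hz).mul_left C)
  rw [norm_mul, norm_pow]
  gcongr
  exact ha n

theorem summable_mul_pow_of_bounded {a : ℕ → ℂ} {C : ℝ} (ha : ∀ n, ‖a n‖ ≤ C) {z : ℂ}
    (hz : ‖z‖ < 1) : Summable fun n => a n * z ^ n :=
  (summable_norm_mul_pow_of_bounded ha hz).of_norm

theorem continuousAt_zero_tsum_of_bounded {a : ℕ → ℂ} {C : ℝ} (ha : ∀ n, ‖a n‖ ≤ C) :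
    ContinuousAt (fun z => ∑' n, a n * z ^ n) 0 := by
  have h : ContinuousOn (fun z : ℂ => ∑' n, a n * z ^ n) (Metric.closedBall 0 (1 / 2)) := by
    refine continuousOn_tsum (fun n => by fun_prop)
      ((summable_geometric_of_lt_one (r := (1 / 2 : ℝ)) (by norm_num) (by norm_num)).mul_left C)
      fun n z hz => ?_
    rw [norm_mul, norm_pow]
    have : ‖z‖ ≤ 1 / 2 := by simpa using hz
    have := (norm_nonneg _).trans (ha n)
    gcongr
    exact ha n
  exact h.continuousAt (Metric.closedBall_mem_nhds _ (by norm_num))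

theorem tsum_mul_zero_pow (a : ℕ → ℂ) : ∑' n, a n * (0 : ℂ) ^ n = a 0 := by
  rw [tsum_eq_single 0]
  · simp
  · intro n hn; simp [hn]

/-! ### The q-binomial theorem -/

/-- The coefficients `(a; q)_m / (q; q)_m` of the q-binomial series. -/
def qBinomCoeff (a q : ℂ) (m : ℕ) : ℂ :=
  (∏ i ∈ Finset.range m, (1 - a * q ^ i)) / ∏ i ∈ Finset.range m, (1 - q ^ (i + 1))

theorem tendsto_prod_one_sub_pow {q : ℂ} (hq : ‖q‖ < 1) :
    Tendsto (fun n => ∏ i ∈ Finset.range n, (1 - q ^ (i + 1))) atTop (𝓝 (qPoch q q)) := by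
  simpa [pow_succ'] using tendsto_prod_qPoch hq q

theorem prod_one_sub_pow_ne_zero {q : ℂ} (hq : ‖q‖ < 1) (m : ℕ) :
    ∏ i ∈ Finset.range m, (1 - q ^ (i + 1)) ≠ 0 :=
  Finset.prod_ne_zero_iff.2 fun i _ => one_sub_pow_ne_zero hq i

theorem exists_norm_qBinomCoeff_le {q : ℂ} (hq : ‖q‖ < 1) (a : ℂ) :
    ∃ C, ∀ m, ‖qBinomCoeff a q m‖ ≤ C :=
  exists_norm_le_of_tendsto
    ((tendsto_prod_qPoch hq a).div (tendsto_prod_one_sub_pow hq) (qPoch_ne_zero hq hq))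

theorem qBinomCoeff_succ {q : ℂ} (hq : ‖q‖ < 1) (a : ℂ) (m : ℕ) :
    qBinomCoeff a q (m + 1) * (1 - q ^ (m + 1)) = qBinomCoeff a q m * (1 - a * q ^ m) := by
  have h1 := prod_one_sub_pow_ne_zero hq m
  have h2 := one_sub_pow_ne_zero hq m
  rw [qBinomCoeff, qBinomCoeff, Finset.prod_range_succ, Finset.prod_range_succ]
  field_simp

theorem summable_qBinom {q : ℂ} (hq : ‖q‖ < 1) (a : ℂ) {z : ℂ} (hz : ‖z‖ < 1) :
    Summable fun m => qBinomCoeff a q m * z ^ m := by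
  obtain ⟨C, hC⟩ := exists_norm_qBinomCoeff_le hq a
  exact summable_mul_pow_of_bounded hC hz

/-- The two-term recurrence of the coefficients, summed against `z ^ (m + 1)`; the constant term of
the difference of the two series cancels. -/
theorem tsum_qBinom_functional {q : ℂ} (hq : ‖q‖ < 1) (a : ℂ) {z : ℂ} (hz : ‖z‖ < 1) :
    (1 - z) * ∑' m, qBinomCoeff a q m * z ^ m =
      (1 - a * z) * ∑' m, qBinomCoeff a q m * (q * z) ^ m := by
  have s1 := summable_qBinom hq a hz
  have s2 := summable_qBinom hq a (norm_q_mul_lt hq hz)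
  have e : ∑' m, (qBinomCoeff a q m * z ^ m - qBinomCoeff a q m * (q * z) ^ m) =
      ∑' m, (z * (qBinomCoeff a q m * z ^ m) - a * z * (qBinomCoeff a q m * (q * z) ^ m)) := by
    rw [(s1.sub s2).tsum_eq_zero_add]
    simp only [pow_zero, sub_self, zero_add]
    refine tsum_congr fun m => ?_
    have := qBinomCoeff_succ hq a m
    rw [mul_pow, mul_pow]
    linear_combination z ^ (m + 1) * this
  rw [s1.tsum_sub s2, (s1.mul_left z).tsum_sub (s2.mul_left (a * z)), tsum_mul_left,
    tsum_mul_left] at e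
  linear_combination e

/-- The q-binomial theorem. -/
theorem tsum_qBinom_mul_qPoch {q : ℂ} (hq : ‖q‖ < 1) {a : ℂ} (ha : ‖a‖ ≤ 1) {z : ℂ}
    (hz : ‖z‖ < 1) :
    (∑' m, qBinomCoeff a q m * z ^ m) * qPoch z q = qPoch (a * z) q := by
  have hne : ∀ w : ℂ, ‖w‖ < 1 → qPoch (a * w) q ≠ 0 := fun w hw =>
    qPoch_ne_zero hq (by
      rw [norm_mul]; exact mul_lt_one_of_nonneg_of_lt_one_right ha (norm_nonneg _) hw)
  obtain ⟨C, hC⟩ := exists_norm_qBinomCoeff_le hq a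
  have hd := (differentiable_qPoch hq).continuous
  -- This quotient is unchanged by `w ↦ q w`, hence constant on the disc, and it is `1` at `0`.
  have hc : ContinuousAt (fun w => (∑' m, qBinomCoeff a q m * w ^ m) * qPoch w q /
      qPoch (a * w) q) 0 := by
    refine ((continuousAt_zero_tsum_of_bounded hC).mul hd.continuousAt).div ?_ (hne 0 (by simp))
    exact (hd.comp (continuous_const_mul a)).continuousAt
  have h := eq_apply_zero_of_invariant hq hc (fun w hw => ?_) hz
  · simp only [tsum_mul_zero_pow, mul_zero, qPoch_zero] at h
    rw [div_eq_iff (hne z hz)] at h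
    simpa [qBinomCoeff] using h
  · have hw' := norm_q_mul_lt hq hw
    rw [div_eq_div_iff (hne w hw) (hne _ hw'), qPoch_eq_mul hq w, qPoch_eq_mul hq (a * w),
      show q * (a * w) = a * (q * w) by ring]
    linear_combination (qPoch (q * w) q * qPoch (a * (q * w)) q) * tsum_qBinom_functional hq a hw

theorem tsum_qBinom_ne_zero {q : ℂ} (hq : ‖q‖ < 1) {a : ℂ} (ha : ‖a‖ ≤ 1) {z : ℂ}
    (hz : ‖z‖ < 1) : ∑' m, qBinomCoeff a q m * z ^ m ≠ 0 := by
  refine left_ne_zero_of_mul (b := qPoch z q) ?_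
  rw [tsum_qBinom_mul_qPoch hq ha hz]
  exact qPoch_ne_zero hq (by
    rw [norm_mul]; exact mul_lt_one_of_nonneg_of_lt_one_right ha (norm_nonneg _) hz)

/-! ### Convergence of solutions of three-term recurrences -/

/-- The larger of two consecutive norms grows by a factor of at most `1 + ‖a n‖ + ‖b n - 1‖` per
step, and the product of these factors is bounded. -/
theorem exists_norm_le_of_recurrence {X a b : ℕ → ℂ}
    (hX : ∀ n, X (n + 2) = b n * X (n + 1) + a n * X n)
    (ha : Summable fun n => ‖a n‖) (hb : Summable fun n => ‖b n - 1‖) :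
    ∃ C, ∀ n, ‖X n‖ ≤ C := by
  set N : ℕ → ℝ := fun n => max ‖X n‖ ‖X (n + 1)‖ with hN
  set ε : ℕ → ℝ := fun n => ‖a n‖ + ‖b n - 1‖ with hε
  have hN0 : ∀ n, 0 ≤ N n := fun n => (norm_nonneg _).trans (le_max_left _ _)
  have hε0 : ∀ n, 0 ≤ ε n := fun n => by positivity
  have step : ∀ n, N (n + 1) ≤ (1 + ε n) * N n := by
    intro n
    have h1 : ‖X n‖ ≤ N n := le_max_left _ _
    have h2 : ‖X (n + 1)‖ ≤ N n := le_max_right _ _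
    refine max_le ?_ ?_
    · nlinarith [hN0 n, hε0 n]
    · rw [hX, show b n * X (n + 1) + a n * X n =
        X (n + 1) + (b n - 1) * X (n + 1) + a n * X n by ring]
      calc _ ≤ ‖X (n + 1)‖ + ‖b n - 1‖ * ‖X (n + 1)‖ + ‖a n‖ * ‖X n‖ := by
            rw [← norm_mul, ← norm_mul]
            exact norm_add₃_le
        _ ≤ N n + ‖b n - 1‖ * N n + ‖a n‖ * N n := by gcongr
        _ = _ := by rw [hε]; ring
  have hprod : ∀ n, N n ≤ (∏ i ∈ Finset.range n, (1 + ε i)) * N 0 := by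
    intro n
    induction n with
    | zero => simp
    | succ n ih =>
      rw [Finset.prod_range_succ]
      calc N (n + 1) ≤ (1 + ε n) * N n := step n
        _ ≤ (1 + ε n) * ((∏ i ∈ Finset.range n, (1 + ε i)) * N 0) := by
            have := hε0 n
            gcongr
        _ = _ := by ring
  refine ⟨Real.exp (∑' n, ε n) * N 0, fun n => (le_max_left _ _).trans ((hprod n).trans ?_)⟩
  refine mul_le_mul_of_nonneg_right ?_ (hN0 0)
  refine (Real.prod_one_add_le_exp_sum _ hε0).trans (Real.exp_le_exp.2 ?_)
  exact (ha.add hb).sum_le_tsum _ fun i _ => hε0 i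

/-- A solution `f` of the backward recurrence that has a nonzero limit determines the limits of
all solutions of the forward recurrence. -/
theorem tendsto_of_recurrence {X a b f : ℕ → ℂ} {L : ℂ}
    (hX : ∀ n, X (n + 2) = b n * X (n + 1) + a n * X n)
    (hf : ∀ n, f n = b n * f (n + 1) + a (n + 1) * f (n + 2))
    (ha : Summable fun n => ‖a n‖) (hb : Summable fun n => ‖b n - 1‖)
    (hL : Tendsto f atTop (𝓝 L)) (hL0 : L ≠ 0) :
    Tendsto X atTop (𝓝 ((X 1 * f 0 + a 0 * X 0 * f 1) / L)) := by
  obtain ⟨C, hC⟩ := exists_norm_le_of_recurrence hX ha hb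
  -- A discrete Wronskian of the forward and the backward solution: it does not depend on `n`. Its
  -- second summand tends to `0`, so the first determines the limit.
  have inv : ∀ n, X (n + 1) * f n + a n * X n * f (n + 1) = X 1 * f 0 + a 0 * X 0 * f 1 := by
    intro n
    induction n with
    | zero => rfl
    | succ n ih =>
      rw [← ih, hX n, hf n]
      ring
  have h0 : Tendsto (fun n => a n * X n) atTop (𝓝 0) := by
    have h := ha.tendsto_atTop_zero.mul_const C
    rw [zero_mul] at h
    refine squeeze_zero_norm (fun n => ?_) h
    rw [norm_mul]
    exact mul_le_mul_of_nonneg_left (hC n) (norm_nonneg _)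
  have h1 : Tendsto (fun n => X (n + 1) * f n) atTop (𝓝 (X 1 * f 0 + a 0 * X 0 * f 1)) := by
    have h := tendsto_const_nhds (x := X 1 * f 0 + a 0 * X 0 * f 1).sub
      (h0.mul (hL.comp (tendsto_add_atTop_nat 1)))
    rw [zero_mul, sub_zero] at h
    refine h.congr fun n => ?_
    rw [← inv n]
    simp
  rw [← tendsto_add_atTop_iff_nat 1]
  refine (h1.div hL hL0).congr' ?_
  filter_upwards [hL.eventually_ne hL0] with n hn
  simp [hn]

/-! ### The tails of the continued fraction -/

/-- The coefficients of the power series in `A²` of the tails of `ramanujanCF`. -/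
def cfTailCoeff (q : ℂ) (n m : ℕ) : ℂ :=
  (∏ i ∈ Finset.range (2 * m), (1 + q ^ (n + i))) * qPoch (q ^ (2 * (n + m) + 1)) (q ^ 2) /
    ∏ i ∈ Finset.range m, (1 - (q ^ 2) ^ (i + 1))

/-- A sequence that satisfies the backward recurrence of `ramanujanCF`; up to normalization it is
`₂φ₁(-qⁿ, -qⁿ⁺¹; q²ⁿ⁺¹; q², x)`. -/
def cfTail (q x : ℂ) (n : ℕ) : ℂ := ∑' m, cfTailCoeff q n m * x ^ m

theorem norm_sq_lt_one {q : ℂ} (hq : ‖q‖ < 1) : ‖q ^ 2‖ < 1 := by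
  rw [norm_pow]; exact pow_lt_one₀ (norm_nonneg _) hq two_ne_zero

theorem qPoch_odd_pow {q : ℂ} (hq : ‖q‖ < 1) (k : ℕ) :
    qPoch (q ^ (2 * k + 1)) (q ^ 2) =
      (1 - q ^ (2 * k + 1)) * qPoch (q ^ (2 * (k + 1) + 1)) (q ^ 2) := by
  rw [qPoch_eq_mul (norm_sq_lt_one hq)]
  congr 2
  ring

theorem cfTailCoeff_zero {q : ℂ} (hq : ‖q‖ < 1) (n : ℕ) :
    cfTailCoeff q n 0 = (1 - q ^ (2 * n + 1)) * cfTailCoeff q (n + 1) 0 := by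
  simp only [cfTailCoeff, mul_zero, Finset.range_zero, Finset.prod_empty, one_mul, add_zero,
    div_one]
  exact qPoch_odd_pow hq n

/-- A contiguous relation, checked coefficientwise. Without the common factors it reads `(1 + qⁿ)(1
- q²ⁿ⁺²ᵐ⁺³) = (1 - q²ⁿ⁺¹)(1 + qⁿ⁺²ᵐ⁺²) + qⁿ(1 + qⁿ⁺¹)(1 - q²ᵐ⁺²)`. -/
theorem cfTailCoeff_succ {q : ℂ} (hq : ‖q‖ < 1) (n m : ℕ) :
    cfTailCoeff q n (m + 1) = (1 - q ^ (2 * n + 1)) * cfTailCoeff q (n + 1) (m + 1) +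
      q ^ n * (1 + q ^ (n + 1)) ^ 2 * cfTailCoeff q (n + 2) m := by
  have h1 : ∏ i ∈ Finset.range (2 * (m + 1)), (1 + q ^ (n + i)) =
      (∏ i ∈ Finset.range (2 * m), (1 + q ^ (n + 2 + i))) * (1 + q ^ (n + 1)) * (1 + q ^ n) := by
    rw [show 2 * (m + 1) = 2 * m + 1 + 1 by ring, Finset.prod_range_succ', Finset.prod_range_succ']
    simp only [add_zero, zero_add]
    congr 2
    exact Finset.prod_congr rfl fun i _ => by ring
  have h2 : ∏ i ∈ Finset.range (2 * (m + 1)), (1 + q ^ (n + 1 + i)) =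
      (∏ i ∈ Finset.range (2 * m), (1 + q ^ (n + 2 + i))) * (1 + q ^ (n + 1)) *
        (1 + q ^ (n + 2 + 2 * m)) := by
    rw [show 2 * (m + 1) = 2 * m + 1 + 1 by ring, Finset.prod_range_succ', Finset.prod_range_succ,
      show n + 1 + (2 * m + 1) = n + 2 + 2 * m by ring, mul_right_comm]
    simp only [add_zero]
    congr 2
    exact Finset.prod_congr rfl fun i _ => by ring
  have h3 := prod_one_sub_pow_ne_zero (norm_sq_lt_one hq) m
  have h4 := one_sub_pow_ne_zero (norm_sq_lt_one hq) m
  simp only [cfTailCoeff]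
  rw [h1, h2, qPoch_odd_pow hq (n + (m + 1)), Finset.prod_range_succ,
    show n + (m + 1) + 1 = n + 2 + m by ring, show n + 1 + (m + 1) = n + 2 + m by ring]
  generalize (∏ i ∈ Finset.range (2 * m), (1 + q ^ (n + 2 + i))) = T
  generalize qPoch (q ^ (2 * (n + 2 + m) + 1)) (q ^ 2) = D
  generalize (∏ i ∈ Finset.range m, (1 - (q ^ 2) ^ (i + 1))) = R at *
  field_simp
  ring

theorem tendsto_qPoch_odd_pow {q : ℂ} (hq : ‖q‖ < 1) :
    Tendsto (fun k : ℕ => qPoch (q ^ (2 * k + 1)) (q ^ 2)) atTop (𝓝 1) := by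
  have h := (differentiable_qPoch (norm_sq_lt_one hq)).continuous.tendsto 0
  rw [qPoch_zero] at h
  refine h.comp ((tendsto_pow_atTop_nhds_zero_of_norm_lt_one hq).comp ?_)
  exact tendsto_atTop_mono (fun k => show k ≤ 2 * k + 1 by omega) tendsto_id

theorem norm_prod_one_add_pow_le {q : ℂ} (hq : ‖q‖ < 1) (n k : ℕ) :
    ‖∏ i ∈ Finset.range k, (1 + q ^ (n + i))‖ ≤ Real.exp (∑' i, ‖q‖ ^ i) := by
  calc _ ≤ ∏ i ∈ Finset.range k, (1 + ‖q‖ ^ i) := by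
        rw [norm_prod]
        refine Finset.prod_le_prod (fun _ _ => norm_nonneg _) fun i _ => ?_
        refine (norm_add_le _ _).trans ?_
        rw [norm_one, norm_pow]
        gcongr 1 + ?_
        exact pow_le_pow_of_le_one (norm_nonneg _) hq.le (by omega)
    _ ≤ Real.exp (∑ i ∈ Finset.range k, ‖q‖ ^ i) :=
        Real.prod_one_add_le_exp_sum _ fun _ => by positivity
    _ ≤ _ := Real.exp_le_exp.2
        ((summable_geometric_of_lt_one (norm_nonneg q) hq).sum_le_tsum _ fun _ _ => by positivity)

/-- Uniformity in `n` as well as `m` is what dominated convergence needs when `n → ∞`. -/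
theorem exists_norm_cfTailCoeff_le {q : ℂ} (hq : ‖q‖ < 1) :
    ∃ C, ∀ n m, ‖cfTailCoeff q n m‖ ≤ C := by
  have hq2 := norm_sq_lt_one hq
  obtain ⟨C₁, h₁⟩ := exists_norm_le_of_tendsto (tendsto_qPoch_odd_pow hq)
  obtain ⟨C₂, h₂⟩ := exists_norm_le_of_tendsto
    ((tendsto_prod_one_sub_pow hq2).inv₀ (qPoch_ne_zero hq2 hq2))
  refine ⟨Real.exp (∑' i, ‖q‖ ^ i) * C₁ * C₂, fun n m => ?_⟩
  have := (norm_nonneg _).trans (h₁ 0)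
  rw [cfTailCoeff, div_eq_mul_inv, norm_mul, norm_mul]
  gcongr
  · exact norm_prod_one_add_pow_le hq n _
  · exact h₁ _
  · exact h₂ m

theorem cfTail_recurrence {q : ℂ} (hq : ‖q‖ < 1) {x : ℂ} (hx : ‖x‖ < 1) (n : ℕ) :
    cfTail q x n = (1 - q ^ (2 * n + 1)) * cfTail q x (n + 1) +
      x * q ^ n * (1 + q ^ (n + 1)) ^ 2 * cfTail q x (n + 2) := by
  obtain ⟨C, hC⟩ := exists_norm_cfTailCoeff_le hq
  have s := fun n => summable_mul_pow_of_bounded (hC n) hx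
  have s1 := (summable_nat_add_iff 1).2 (s (n + 1))
  simp only [cfTail]
  rw [(s n).tsum_eq_zero_add, (s (n + 1)).tsum_eq_zero_add, cfTailCoeff_zero hq, mul_add,
    ← tsum_mul_left, ← tsum_mul_left, add_assoc, ← (s1.mul_left _).tsum_add ((s (n + 2)).mul_left _)]
  congr 1
  · ring
  · refine tsum_congr fun m => ?_
    rw [cfTailCoeff_succ hq]
    ring

/-- For fixed `m` the coefficients tend to `1 / (q²; q²)_m`. Writing these as q-binomial
coefficients with `a = 0` and base `q²` makes the limit `1 / (x; q²)_∞`, which is nonzero. -/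
theorem tendsto_cfTail {q : ℂ} (hq : ‖q‖ < 1) {x : ℂ} (hx : ‖x‖ < 1) :
    Tendsto (cfTail q x) atTop (𝓝 (∑' m, qBinomCoeff 0 (q ^ 2) m * x ^ m)) := by
  obtain ⟨C, hC⟩ := exists_norm_cfTailCoeff_le hq
  refine tendsto_tsum_of_dominated_convergence
    ((summable_geometric_of_lt_one (norm_nonneg x) hx).mul_left C) (fun m => ?_)
    (.of_forall fun n m => ?_)
  · refine Tendsto.mul_const _ (Tendsto.div_const ?_ _)
    simp only [zero_mul, sub_zero]
    have h1 : Tendsto (fun n => ∏ i ∈ Finset.range (2 * m), (1 + q ^ (n + i))) atTop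
        (𝓝 (∏ i ∈ Finset.range (2 * m), 1)) := by
      refine tendsto_finsetProd _ fun i _ => ?_
      simpa using tendsto_const_nhds.add ((tendsto_pow_atTop_nhds_zero_of_norm_lt_one hq).comp
        (tendsto_add_atTop_nat i))
    have h2 := (tendsto_qPoch_odd_pow hq).comp (tendsto_add_atTop_nat m)
    simpa using h1.mul h2
  · rw [norm_mul, norm_pow]
    gcongr
    exact hC n m

theorem prod_range_two_mul_one_sub_pow (q : ℂ) (m : ℕ) :
    ∏ i ∈ Finset.range (2 * m), (1 - q ^ (i + 1)) =
      (∏ i ∈ Finset.range m, (1 - q * (q ^ 2) ^ i)) *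
        ∏ i ∈ Finset.range m, (1 - (q ^ 2) ^ (i + 1)) := by
  induction m with
  | zero => simp
  | succ m ih =>
    rw [show 2 * (m + 1) = 2 * m + 1 + 1 by ring, Finset.prod_range_succ, Finset.prod_range_succ,
      ih, Finset.prod_range_succ, Finset.prod_range_succ]
    ring

theorem cfTailCoeff_zero_left {q : ℂ} (hq : ‖q‖ < 1) (m : ℕ) :
    cfTailCoeff q 0 m = qPoch q (q ^ 2) * qBinomCoeff (-1) q (2 * m) := by
  have h := prod_one_sub_pow_ne_zero hq (2 * m)
  rw [cfTailCoeff, qBinomCoeff, qPoch_eq_prod_mul (norm_sq_lt_one hq) q m]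
  rw [prod_range_two_mul_one_sub_pow] at h ⊢
  have h1 := left_ne_zero_of_mul h
  have h2 := right_ne_zero_of_mul h
  rw [show (q ^ 2) ^ m * q = q ^ (2 * (0 + m) + 1) by ring]
  simp only [zero_add, neg_one_mul, sub_neg_eq_add]
  field_simp

/-- The factor `2` is the term `1 + q⁰` of `(-1; q)_{2m+1}`, which the product in `cfTailCoeff q 1
m`, starting at `1 + q`, lacks. -/
theorem cfTailCoeff_one_left {q : ℂ} (hq : ‖q‖ < 1) (m : ℕ) :
    2 * cfTailCoeff q 1 m = qPoch q (q ^ 2) * qBinomCoeff (-1) q (2 * m + 1) := by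
  have h := prod_one_sub_pow_ne_zero hq (2 * m)
  have h3 := one_sub_pow_ne_zero hq (2 * m)
  rw [cfTailCoeff, qBinomCoeff, qPoch_eq_prod_mul (norm_sq_lt_one hq) q (m + 1),
    Finset.prod_range_succ' (fun i => 1 - -1 * q ^ i),
    Finset.prod_range_succ (fun i => 1 - q ^ (i + 1)),
    Finset.prod_range_succ (fun i => 1 - q * (q ^ 2) ^ i)]
  rw [prod_range_two_mul_one_sub_pow] at h ⊢
  have h1 := left_ne_zero_of_mul h
  have h2 := right_ne_zero_of_mul h
  rw [show (q ^ 2) ^ (m + 1) * q = q ^ (2 * (1 + m) + 1) by ring,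
    show q * (q ^ 2) ^ m = q ^ (2 * m + 1) by ring]
  simp only [neg_one_mul, sub_neg_eq_add, pow_zero, add_comm 1 (_ : ℕ)]
  field_simp
  ring

/-- The two tails are the even and the odd part of a single q-binomial series in `A`. -/
theorem cfTail_zero_add {q : ℂ} (hq : ‖q‖ < 1) {A : ℂ} (hA : ‖A‖ < 1) :
    cfTail q (A ^ 2) 0 + 2 * A * cfTail q (A ^ 2) 1 =
      qPoch q (q ^ 2) * ∑' m, qBinomCoeff (-1) q m * A ^ m := by
  obtain ⟨C, hC⟩ := exists_norm_cfTailCoeff_le hq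
  have s := summable_qBinom hq (-1) hA
  have he : Summable fun k : ℕ => qBinomCoeff (-1) q (2 * k) * A ^ (2 * k) :=
    s.comp_injective (i := fun k => 2 * k) fun a b h => by simpa using h
  have ho : Summable fun k : ℕ => qBinomCoeff (-1) q (2 * k + 1) * A ^ (2 * k + 1) :=
    s.comp_injective (i := fun k => 2 * k + 1) fun a b h => by simpa using h
  have h := tsum_even_add_odd (f := fun m => qBinomCoeff (-1) q m * A ^ m) he ho
  rw [← h, mul_add, cfTail, cfTail, ← tsum_mul_left, ← tsum_mul_left, ← tsum_mul_left]
  congr 1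
  · exact tsum_congr fun m => by rw [cfTailCoeff_zero_left hq]; ring
  · exact tsum_congr fun m => by linear_combination (A ^ (2 * m + 1)) * cfTailCoeff_one_left hq m

/-! ### Convergence and value of the continued fraction -/

theorem ramanujanCF_num_recurrence (q A : ℂ) (n : ℕ) :
    (ramanujanCF q A).nums (n + 2) = (cfPair q A (n + 1)).b * (ramanujanCF q A).nums (n + 1) +
      (cfPair q A (n + 1)).a * (ramanujanCF q A).nums n :=
  GenContFract.nums_recurrence rfl rfl rfl

theorem ramanujanCF_den_recurrence (q A : ℂ) (n : ℕ) :
    (ramanujanCF q A).dens (n + 2) = (cfPair q A (n + 1)).b * (ramanujanCF q A).dens (n + 1) +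
      (cfPair q A (n + 1)).a * (ramanujanCF q A).dens n :=
  GenContFract.dens_recurrence rfl rfl rfl

theorem ramanujanCF_num_zero (q A : ℂ) : (ramanujanCF q A).nums 0 = -1 :=
  GenContFract.zeroth_num_eq_h

theorem ramanujanCF_num_one (q A : ℂ) : (ramanujanCF q A).nums 1 = 1 := by
  rw [GenContFract.first_num_eq (gp := cfPair q A 0) rfl]
  simp [ramanujanCF, cfPair]
  norm_num

theorem ramanujanCF_den_one (q A : ℂ) : (ramanujanCF q A).dens 1 = 1 := by
  rw [GenContFract.first_den_eq (gp := cfPair q A 0) rfl]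
  simp [cfPair]

theorem summable_norm_cfPair_a {q : ℂ} (hq : ‖q‖ < 1) (A : ℂ) :
    Summable fun n => ‖(cfPair q A (n + 1)).a‖ := by
  rw [← summable_nat_add_iff 1]
  refine Summable.of_nonneg_of_le (fun _ => norm_nonneg _) (fun n => ?_)
    ((summable_geometric_of_lt_one (norm_nonneg q) hq).mul_left (‖A‖ ^ 2 * 2 ^ 2))
  have : ‖1 + q ^ (n + 1)‖ ≤ 2 := by
    refine (norm_add_le _ _).trans ?_
    rw [norm_one, norm_pow]
    linarith [pow_le_one₀ (n := n + 1) (norm_nonneg q) hq.le]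
  simp only [cfPair, norm_mul, norm_pow]
  calc _ ≤ ‖A‖ ^ 2 * ‖q‖ ^ n * 2 ^ 2 := by gcongr
    _ = _ := by ring

theorem cfPair_succ_b (q A : ℂ) (n : ℕ) : (cfPair q A (n + 1)).b = 1 - q ^ (2 * n + 1) := by
  cases n <;> simp [cfPair]
  ring

theorem summable_norm_cfPair_b_sub_one {q : ℂ} (hq : ‖q‖ < 1) (A : ℂ) :
    Summable fun n => ‖(cfPair q A (n + 1)).b - 1‖ := by
  simp only [cfPair_succ_b, sub_sub_cancel_left, norm_neg, norm_pow]
  exact (summable_geometric_of_lt_one (norm_nonneg q) hq).comp_injective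
    (i := fun k => 2 * k + 1) fun a b h => by simpa using h

/-- The indices start at pair `1`: the pair `⟨2, 1⟩` enters only through the initial values of the
numerators and denominators. -/
theorem cfTail_backward {q : ℂ} (hq : ‖q‖ < 1) {A : ℂ} (hA : ‖A ^ 2‖ < 1) (n : ℕ) :
    cfTail q (A ^ 2) n = (cfPair q A (n + 1)).b * cfTail q (A ^ 2) (n + 1) +
      (cfPair q A (n + 1 + 1)).a * cfTail q (A ^ 2) (n + 2) := by
  rw [cfPair_succ_b]
  exact cfTail_recurrence hq hA n

/-- The value of the continued fraction is `((-A; q)_∞ / (A; q)_∞)²`. -/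
theorem ramanujanCF_convergesTo {q : ℂ} (hq : ‖q‖ < 1) {A : ℂ} (hA : ‖A‖ < 1) :
    CFConvergesTo (ramanujanCF q A) (qPochQuot q A ^ 2) := by
  have hA2 := norm_sq_lt_one hA
  have hA' : ‖-A‖ < 1 := by rwa [norm_neg]
  have hL := tsum_qBinom_ne_zero (norm_sq_lt_one hq) (a := 0) (by simp) hA2
  have hD := qPoch_ne_zero (norm_sq_lt_one hq) hq
  have hn := tendsto_of_recurrence (ramanujanCF_num_recurrence q A) (cfTail_backward hq hA2)
    (summable_norm_cfPair_a hq A) (summable_norm_cfPair_b_sub_one hq A) (tendsto_cfTail hq hA2) hL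
  have hd := tendsto_of_recurrence (ramanujanCF_den_recurrence q A) (cfTail_backward hq hA2)
    (summable_norm_cfPair_a hq A) (summable_norm_cfPair_b_sub_one hq A) (tendsto_cfTail hq hA2) hL
  rw [ramanujanCF_num_zero, ramanujanCF_num_one] at hn
  rw [GenContFract.zeroth_den_eq_one, ramanujanCF_den_one] at hd
  have e1 := cfTail_zero_add hq hA
  have e2 := cfTail_zero_add hq hA'
  rw [neg_sq] at e2
  simp only [cfPair] at hn hd
  -- The initial values `-1, 1` of the numerators and `1, 1` of the denominators turn the conserved
  -- quantity into `f₀ + 2A f₁` and `f₀ - 2A f₁`; the second is the first at `-A`.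
  rw [show (1 : ℂ) * cfTail q (A ^ 2) 0 + -2 * A * -1 * cfTail q (A ^ 2) 1 =
    cfTail q (A ^ 2) 0 + 2 * A * cfTail q (A ^ 2) 1 by ring, e1] at hn
  rw [show (1 : ℂ) * cfTail q (A ^ 2) 0 + -2 * A * 1 * cfTail q (A ^ 2) 1 =
    cfTail q (A ^ 2) 0 + 2 * -A * cfTail q (A ^ 2) 1 by ring, e2] at hd
  have b1 := tsum_qBinom_mul_qPoch hq (a := -1) (by simp) hA
  have b2 := tsum_qBinom_mul_qPoch hq (a := -1) (by simp) hA'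
  have hb2 := tsum_qBinom_ne_zero hq (a := -1) (by simp) hA'
  have p1 := qPoch_ne_zero hq hA
  have p2 := qPoch_ne_zero hq hA'
  rw [neg_one_mul] at b1 b2
  rw [neg_neg] at b2
  have hd0 := div_ne_zero (mul_ne_zero hD hb2) hL
  refine ⟨hd.eventually_ne hd0, ?_⟩
  have h := hn.div hd hd0
  rw [div_div_div_cancel_right₀ hL, mul_div_mul_left _ _ hD] at h
  -- The two sums are `Q(A)` and `Q(-A) = 1 / Q(A)`.
  have e : (∑' m, qBinomCoeff (-1) q m * A ^ m) / ∑' m, qBinomCoeff (-1) q m * (-A) ^ m =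
      qPochQuot q A ^ 2 := by
    rw [qPochQuot, div_pow, div_eq_div_iff hb2 (pow_ne_zero 2 p1)]
    refine mul_right_cancel₀ p2 ?_
    linear_combination qPoch A q * qPoch (-A) q * b1 - qPoch (-A) q ^ 2 * b2
  rw [e] at h
  exact h

theorem cfValue_eq {q : ℂ} (hq : ‖q‖ < 1) {A : ℂ} (hA : ‖A‖ < 1) :
    cfValue q A = qPochQuot q A ^ 2 :=
  (ramanujanCF_convergesTo hq hA).2.limUnder_eq

/-! ### The Lambert series of the logarithmic derivative -/

theorem differentiableAt_qPochQuot {q : ℂ} (hq : ‖q‖ < 1) {z : ℂ} (hz : ‖z‖ < 1) :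
    DifferentiableAt ℂ (qPochQuot q) z :=
  ((differentiable_qPoch hq).comp differentiable_neg z).div (differentiable_qPoch hq z)
    (qPoch_ne_zero hq hz)

theorem qPochQuot_ne_zero {q : ℂ} (hq : ‖q‖ < 1) {z : ℂ} (hz : ‖z‖ < 1) : qPochQuot q z ≠ 0 :=
  div_ne_zero (qPoch_ne_zero hq (by rwa [norm_neg])) (qPoch_ne_zero hq hz)

theorem isOpen_norm_lt_one : IsOpen {z : ℂ | ‖z‖ < 1} := isOpen_lt continuous_norm continuous_const

theorem analyticAt_qPochQuot {q : ℂ} (hq : ‖q‖ < 1) {z : ℂ} (hz : ‖z‖ < 1) :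
    AnalyticAt ℂ (qPochQuot q) z :=
  DifferentiableOn.analyticAt (s := {z : ℂ | ‖z‖ < 1})
    (fun _ hw => (differentiableAt_qPochQuot hq hw).differentiableWithinAt)
    (isOpen_norm_lt_one.mem_nhds hz)

theorem analyticAt_logDeriv_qPochQuot {q : ℂ} (hq : ‖q‖ < 1) {z : ℂ} (hz : ‖z‖ < 1) :
    AnalyticAt ℂ (logDeriv (qPochQuot q)) z :=
  (analyticAt_qPochQuot hq hz).deriv.div (analyticAt_qPochQuot hq hz) (qPochQuot_ne_zero hq hz)

theorem qPochQuot_eq_mul {q : ℂ} (hq : ‖q‖ < 1) (z : ℂ) :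
    qPochQuot q z = (1 + z) / (1 - z) * qPochQuot q (q * z) := by
  rw [qPochQuot, qPochQuot, qPoch_eq_mul hq z, qPoch_eq_mul hq (-z), sub_neg_eq_add, mul_neg,
    div_mul_div_comm]

/-- The product formula `Q(z) = (1 + z) / (1 - z) · Q(qz)`, differentiated logarithmically. -/
theorem logDeriv_qPochQuot_functional {q : ℂ} (hq : ‖q‖ < 1) {z : ℂ} (hz : ‖z‖ < 1) :
    logDeriv (qPochQuot q) z = 2 / (1 - z ^ 2) + q * logDeriv (qPochQuot q) (q * z) := by
  have h1 : 1 - z ≠ 0 := one_sub_ne_zero_of_norm_lt hz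
  have h2 : 1 + z ≠ 0 := by
    have := one_sub_ne_zero_of_norm_lt (z := -z) (by rwa [norm_neg])
    rwa [sub_neg_eq_add] at this
  have h3 : 1 - z ^ 2 ≠ 0 := by
    rw [show 1 - z ^ 2 = (1 - z) * (1 + z) by ring]; exact mul_ne_zero h1 h2
  have hqz := norm_q_mul_lt hq hz
  have d3 := differentiableAt_qPochQuot hq hqz
  have d4 : DifferentiableAt ℂ (fun w : ℂ => q * w) z := by fun_prop
  have e : qPochQuot q = fun w => (1 + w) / (1 - w) * (qPochQuot q ∘ fun w => q * w) w :=
    funext fun w => qPochQuot_eq_mul hq w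
  conv_lhs => rw [e]
  rw [logDeriv_mul (f := fun w => (1 + w) / (1 - w)) (g := qPochQuot q ∘ fun w => q * w) z
    (div_ne_zero h2 h1) (qPochQuot_ne_zero hq hqz) (by fun_prop (disch := assumption)) (d3.comp z d4),
    logDeriv_div z h2 h1 (by fun_prop) (by fun_prop), logDeriv_comp d3 d4]
  simp only [logDeriv_apply]
  have t1 : deriv (fun w : ℂ => 1 + w) z = 1 := by simp
  have t2 : deriv (fun w : ℂ => 1 - w) z = -1 := by simp
  have t3 : deriv (fun w : ℂ => q * w) z = q := by simp
  rw [t1, t2, t3, mul_comm q (_ / _)]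
  congr 1
  field_simp
  ring

theorem exists_norm_lambertCoeff_le {q : ℂ} (hq : ‖q‖ < 1) :
    ∃ C, ∀ n : ℕ, ‖(1 - q ^ (2 * n + 1))⁻¹‖ ≤ C := by
  refine exists_norm_le_of_tendsto (l := (1 - 0)⁻¹) (Tendsto.inv₀ ?_ (by simp))
  refine tendsto_const_nhds.sub ((tendsto_pow_atTop_nhds_zero_of_norm_lt_one hq).comp ?_)
  exact tendsto_atTop_mono (fun k => show k ≤ 2 * k + 1 by omega) tendsto_id

/-- The Lambert series `∑ z²ⁿ⁺¹ / (1 - q²ⁿ⁺¹)` as a logarithmic derivative. -/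
theorem hasSum_lambert {q : ℂ} (hq : ‖q‖ < 1) {z : ℂ} (hz : ‖z‖ < 1) :
    HasSum (fun n : ℕ => z ^ (2 * n + 1) / (1 - q ^ (2 * n + 1)))
      (z / 2 * logDeriv (qPochQuot q) z) := by
  obtain ⟨C, hC⟩ := exists_norm_lambertCoeff_le hq
  set a : ℕ → ℂ := fun n => (1 - q ^ (2 * n + 1))⁻¹ with ha
  have s : ∀ w : ℂ, ‖w‖ < 1 → Summable fun n => a n * (w ^ 2) ^ n := fun w hw =>
    summable_mul_pow_of_bounded hC (norm_sq_lt_one hw)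
  -- Termwise `1 / (1 - p) = 1 + p / (1 - p)` with `p = q²ⁿ⁺¹`; the ones add up to a geometric
  -- series.
  have func : ∀ w : ℂ, ‖w‖ < 1 → ∑' n, a n * (w ^ 2) ^ n =
      1 / (1 - w ^ 2) + q * ∑' n, a n * ((q * w) ^ 2) ^ n := by
    intro w hw
    rw [one_div, ← tsum_geometric_of_norm_lt_one (norm_sq_lt_one hw), ← tsum_mul_left,
      ← (summable_geometric_of_norm_lt_one (norm_sq_lt_one hw)).tsum_add
        ((s _ (norm_q_mul_lt hq hw)).mul_left q)]
    refine tsum_congr fun n => ?_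
    have h := one_sub_pow_ne_zero hq (2 * n)
    rw [ha]
    field_simp
    ring
  -- The difference `D` of the two solutions satisfies `D(w) = q D(qw)`. The extra factor `w` makes
  -- it invariant and forces the value `0` at `0`.
  have hcont : ContinuousAt (fun w => w * (logDeriv (qPochQuot q) w -
      2 * ∑' n, a n * (w ^ 2) ^ n)) 0 := by
    refine continuousAt_id.mul (((analyticAt_logDeriv_qPochQuot hq (by simp)).continuousAt).sub
      (continuousAt_const.mul ?_))
    have h := continuousAt_zero_tsum_of_bounded hC
    exact ContinuousAt.comp_of_eq (f := fun w : ℂ => w ^ 2) h (by fun_prop) (by simp)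
  have key := eq_apply_zero_of_invariant hq hcont (fun w hw => by
    rw [logDeriv_qPochQuot_functional hq hw, func w hw]; ring) hz
  have h := (s z hz).hasSum.mul_left z
  have e : z * ∑' n, a n * (z ^ 2) ^ n = z / 2 * logDeriv (qPochQuot q) z := by
    linear_combination -(1 / 2) * key
  rw [e] at h
  refine h.congr_fun fun n => ?_
  rw [ha]
  ring

/-! ### Meromorphic continuation -/

/-- Passing to the normal form does not change values at points of analyticity, so the sums on `S`
survive. -/
theorem isContinuationOfSeries_toMeromorphicNFOn {a : ℕ → ℂ → ℂ} {S U : Set ℂ} {g : ℂ → ℂ}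
    (hg : MeromorphicOn g U) (hSU : S ⊆ U) (hS : ∀ u ∈ S, AnalyticAt ℂ g u)
    (hsum : ∀ u ∈ S, HasSum (fun n => a n u) (g u)) :
    IsContinuationOfSeries a S U (toMeromorphicNFOn g U) := by
  refine ⟨meromorphicNFOn_toMeromorphicNFOn g U, fun u hu => ?_⟩
  rw [toMeromorphicNFOn_eq_toMeromorphicNFAt hg (hSU hu),
    toMeromorphicNFAt_eq_self.2 (hS u hu).meromorphicNFAt]
  exact hsum u hu

theorem isContinuationOfSeries_continuationOfSeries {a : ℕ → ℂ → ℂ} {S U : Set ℂ}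
    (h : ∃ g, IsContinuationOfSeries a S U g) :
    IsContinuationOfSeries a S U (continuationOfSeries a S U) := by
  rw [continuationOfSeries, dif_pos h]
  exact Classical.choose_spec h

/-- The identity theorem for meromorphic functions. -/
theorem eventuallyEq_nhdsNE_of_eqOn {f g : ℂ → ℂ} {S U : Set ℂ} (hf : MeromorphicOn f U)
    (hg : MeromorphicOn g U) (hU : IsPreconnected U) (hS : IsOpen S) (hSU : S ⊆ U)
    (hne : S.Nonempty) (hfg : Set.EqOn f g S) {x : ℂ} (hx : x ∈ U) : f =ᶠ[𝓝[≠] x] g := by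
  obtain ⟨y, hy⟩ := hne
  have htop : meromorphicOrderAt (f - g) y = ⊤ := by
    rw [meromorphicOrderAt_eq_top_iff]
    filter_upwards [nhdsWithin_le_nhds (hS.mem_nhds hy)] with z hz
    simp [hfg hz]
  have hx' : meromorphicOrderAt (f - g) x = ⊤ := by
    by_contra h
    exact (hf.sub hg).meromorphicOrderAt_ne_top_of_isPreconnected hU hx (hSU hy) h htop
  filter_upwards [meromorphicOrderAt_eq_top_iff.1 hx'] with z hz
  simpa [sub_eq_zero] using hz

/-! ### The half plane and the strip -/

theorem norm_nomeA (q k : ℝ) (t : ℂ) :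
    ‖nomeA q k t‖ = ‖(√q : ℂ) * Complex.exp (Complex.I * Real.pi * t / (2 * ellK k))‖ := by
  rw [nomeA, mul_assoc, norm_mul, Complex.norm_I, one_mul]

theorem mem_halfPlane_iff {q k : ℝ} {t : ℂ} : t ∈ halfPlane q k ↔ ‖nomeA q k t‖ < 1 := by
  rw [norm_nomeA]; rfl

theorem differentiable_nomeA (q k : ℝ) : Differentiable ℂ (nomeA q k) := by
  unfold nomeA
  fun_prop

theorem deriv_nomeA (q k : ℝ) (t : ℂ) :
    deriv (nomeA q k) t = Complex.I * Real.pi / (2 * ellK k) * nomeA q k t := by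
  have h : HasDerivAt (fun t : ℂ => Complex.I * Real.pi * t / (2 * ellK k))
      (Complex.I * Real.pi / (2 * ellK k)) t := by
    simpa using ((hasDerivAt_id t).const_mul (Complex.I * Real.pi)).div_const (2 * (ellK k : ℂ))
  have h2 := (h.cexp.const_mul (Complex.I * (√q : ℂ))).deriv
  change deriv (fun t => Complex.I * (√q : ℂ) *
    Complex.exp (Complex.I * Real.pi * t / (2 * ellK k))) t = _
  rw [h2, nomeA]
  ring

theorem isOpen_halfPlane (q k : ℝ) : IsOpen (halfPlane q k) := by
  have : halfPlane q k = {t | ‖nomeA q k t‖ < 1} := Set.ext fun t => mem_halfPlane_iff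
  rw [this]
  exact isOpen_lt (differentiable_nomeA q k).continuous.norm continuous_const

/-- Logarithms turn the condition into a real linear inequality in `Im t`, whatever the sign of
`ellK k`. Convexity supplies the connectedness for the identity theorem. -/
theorem convex_halfPlane {q : ℝ} (hq : 0 < q) (k : ℝ) : Convex ℝ (halfPlane q k) := by
  have : halfPlane q k =
      {t : ℂ | (-(Real.pi / (2 * ellK k))) * Complex.imLm t < -Real.log (√q)} := by
    ext t
    have hs : 0 < √q := Real.sqrt_pos.2 hq
    have e : (Complex.I * Real.pi * t / (2 * ellK k)).re = -(Real.pi / (2 * ellK k)) * t.im := by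
      rw [show Complex.I * Real.pi * t / (2 * ellK k) =
        ((Real.pi / (2 * ellK k) : ℝ) : ℂ) * (Complex.I * t) by push_cast; ring,
        Complex.re_ofReal_mul]
      simp
    simp only [halfPlane, Set.mem_ofPred_eq, norm_mul, Complex.norm_exp, e, Complex.norm_real,
      Real.norm_of_nonneg hs.le]
    rw [← Real.log_lt_log_iff (by positivity) one_pos, Real.log_mul hs.ne' (Real.exp_ne_zero _),
      Real.log_exp, Real.log_one]
    constructor <;> intro h <;> simp at h ⊢ <;> linarith
  rw [this]
  exact convex_halfSpace_lt (((-(Real.pi / (2 * ellK k))) • Complex.imLm).isLinear) _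

theorem isOpen_strip (q k : ℝ) : IsOpen (strip q k) :=
  IsOpen.inter (s := halfPlane q k) (t := (fun u => -u) ⁻¹' halfPlane q k) (isOpen_halfPlane q k)
    ((isOpen_halfPlane q k).preimage continuous_neg)

theorem zero_mem_strip {q : ℝ} (hq : q < 1) (k : ℝ) : (0 : ℂ) ∈ strip q k := by
  have h : (0 : ℂ) ∈ halfPlane q k := by
    have : √q < 1 := by rw [Real.sqrt_lt' one_pos]; simpa using hq
    simpa [halfPlane, abs_of_nonneg (Real.sqrt_nonneg q)] using this
  exact ⟨h, by simpa using h⟩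

/-! ### The series of `cd` and `cd₁` -/

/-- The logarithmic derivative of `(-A; q)_∞ / (A; q)_∞` as a function of `t`. -/
def nomeLogDeriv (q k : ℝ) : ℂ → ℂ := logDeriv fun t => qPochQuot q (nomeA q k t)

theorem norm_ofReal_lt_one {q : ℝ} (hq0 : 0 < q) (hq : q < 1) : ‖(q : ℂ)‖ < 1 := by
  rwa [Complex.norm_real, Real.norm_of_nonneg hq0.le]

/-- Valid on all of `ℂ`, because both infinite products are entire; this is what continues `cd`
beyond the strip. -/
theorem meromorphicAt_nomeLogDeriv {q : ℝ} (hq0 : 0 < q) (hq : q < 1) (k : ℝ) (t : ℂ) :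
    MeromorphicAt (nomeLogDeriv q k) t := by
  have hP := differentiable_qPoch (norm_ofReal_lt_one hq0 hq)
  have hA := differentiable_nomeA q k
  exact (((hP.comp hA.neg).analyticAt t).meromorphicAt.div
    ((hP.comp hA).analyticAt t).meromorphicAt).logDeriv

theorem nomeLogDeriv_eq {q : ℝ} (hq0 : 0 < q) (hq : q < 1) {k : ℝ} {t : ℂ}
    (ht : t ∈ halfPlane q k) : nomeLogDeriv q k t =
      logDeriv (qPochQuot q) (nomeA q k t) *
        (Complex.I * Real.pi / (2 * ellK k) * nomeA q k t) := by
  have h := logDeriv_comp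
    (differentiableAt_qPochQuot (norm_ofReal_lt_one hq0 hq) (mem_halfPlane_iff.1 ht))
    (differentiable_nomeA q k t)
  rw [deriv_nomeA] at h
  exact h

theorem analyticAt_nomeLogDeriv {q : ℝ} (hq0 : 0 < q) (hq : q < 1) {k : ℝ} {t : ℂ}
    (ht : t ∈ halfPlane q k) : AnalyticAt ℂ (nomeLogDeriv q k) t := by
  have hA := (differentiable_nomeA q k).analyticAt t
  have h1 := (analyticAt_qPochQuot (norm_ofReal_lt_one hq0 hq) (mem_halfPlane_iff.1 ht)).comp hA
  exact h1.deriv.div h1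
    (qPochQuot_ne_zero (norm_ofReal_lt_one hq0 hq) (mem_halfPlane_iff.1 ht))

theorem nomeA_pow {q : ℝ} (hq0 : 0 < q) (k : ℝ) (u : ℂ) (n : ℕ) :
    nomeA q k u ^ (2 * n + 1) = Complex.I * ((-1) ^ n * (q ^ ((n : ℝ) + 1 / 2) : ℝ) *
      Complex.exp ((2 * n + 1) * (Real.pi * u / (2 * ellK k)) * Complex.I)) := by
  have h1 : ((q ^ ((n : ℝ) + 1 / 2) : ℝ) : ℂ) = (√q : ℂ) ^ (2 * n + 1) := by
    rw [← Complex.ofReal_pow, Real.sqrt_eq_rpow, ← Real.rpow_natCast, ← Real.rpow_mul hq0.le]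
    congr 2
    push_cast
    ring
  have h2 : Complex.I ^ (2 * n + 1) = Complex.I * (-1) ^ n := by
    rw [pow_succ, pow_mul, Complex.I_sq, mul_comm]
  rw [nomeA, mul_pow, mul_pow, ← Complex.exp_nat_mul, h1, h2]
  push_cast
  rw [show (2 * (n : ℂ) + 1) * (Complex.I * Real.pi * u / (2 * ellK k)) =
    (2 * n + 1) * (Real.pi * u / (2 * ellK k)) * Complex.I by ring]
  ring

/-- The exponential part of the Fourier series of `cd`. -/
def expTerm (q k : ℝ) (n : ℕ) (u : ℂ) : ℂ :=
  (-1) ^ n * (q ^ ((n : ℝ) + 1 / 2) : ℝ) *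
    Complex.exp ((2 * n + 1) * (Real.pi * u / (2 * ellK k)) * Complex.I) /
      (1 - (q : ℂ) ^ (2 * n + 1))

/-- Only the half plane is needed here, not the strip. The constant comes from `A' = (iπ / (2K)) A`
and the factor `-i` that undoes the `i` in `A²ⁿ⁺¹`. -/
theorem hasSum_expTerm {q : ℝ} (hq0 : 0 < q) (hq : q < 1) {k : ℝ} (hK : ellK k ≠ 0) {u : ℂ}
    (hu : u ∈ halfPlane q k) :
    HasSum (fun n => expTerm q k n u) (-(ellK k / Real.pi) * nomeLogDeriv q k u) := by
  have h := (hasSum_lambert (norm_ofReal_lt_one hq0 hq) (mem_halfPlane_iff.1 hu)).mul_left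
    (-Complex.I)
  have hK' : (ellK k : ℂ) ≠ 0 := by exact_mod_cast hK
  have hpi : (Real.pi : ℂ) ≠ 0 := by exact_mod_cast Real.pi_ne_zero
  have e : -(ellK k / Real.pi : ℂ) * nomeLogDeriv q k u =
      -Complex.I * (nomeA q k u / 2 * logDeriv (qPochQuot q) (nomeA q k u)) := by
    rw [nomeLogDeriv_eq hq0 hq hu]
    field_simp
  rw [e]
  refine h.congr_fun fun n => ?_
  rw [nomeA_pow hq0, expTerm]
  linear_combination ((-1) ^ n * (q ^ ((n : ℝ) + 1 / 2) : ℝ) *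
    Complex.exp ((2 * n + 1) * (Real.pi * u / (2 * ellK k)) * Complex.I) /
      (1 - (q : ℂ) ^ (2 * n + 1))) * Complex.I_sq

theorem cdTerm_eq (q k : ℝ) (n : ℕ) (u : ℂ) :
    cdTerm q k n u = Real.pi / (ellK k * k) * (expTerm q k n u + expTerm q k n (-u)) := by
  rw [cdTerm, expTerm, expTerm, Complex.cos, mul_neg (Real.pi : ℂ) u, neg_div, mul_neg]
  ring

/-- `cos (a + b)` with `b = πu/K`, where `sin a = i cos a - i e^{ia}` removes the sine series. -/
theorem cd1Term_eq (q k : ℝ) (n : ℕ) (u : ℂ) :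
    cd1Term q k n u = cdTerm q k n u * Complex.cos (Real.pi * u / ellK k)
      - Complex.I * cdTerm q k n u * Complex.sin (Real.pi * u / ellK k)
      + Complex.I * (2 * Real.pi / (ellK k * k)) * Complex.sin (Real.pi * u / ellK k) *
        expTerm q k n u := by
  have e : (2 * (n : ℂ) + 3) * (Real.pi * u / (2 * ellK k)) =
      (2 * n + 1) * (Real.pi * u / (2 * ellK k)) + Real.pi * u / ellK k := by
    field_simp
    ring
  rw [cd1Term, e, Complex.cos_add, cdTerm, expTerm, Complex.exp_mul_I]
  generalize Complex.sin (Real.pi * u / ellK k) = S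
  generalize Complex.sin ((2 * (n : ℂ) + 1) * (Real.pi * u / (2 * ellK k))) = T
  linear_combination (-(2 * Real.pi / (ellK k * k)) * ((-1) ^ n * (q ^ ((n : ℝ) + 1 / 2) : ℝ)
    * S * T / (1 - (q : ℂ) ^ (2 * n + 1)))) * Complex.I_sq

theorem hasSum_cdTerm {q : ℝ} (hq0 : 0 < q) (hq : q < 1) {k : ℝ} (hK : ellK k ≠ 0) {u : ℂ}
    (hu : u ∈ strip q k) : HasSum (fun n => cdTerm q k n u)
      (-(k : ℂ)⁻¹ * (nomeLogDeriv q k u + nomeLogDeriv q k (-u))) := by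
  have h := ((hasSum_expTerm hq0 hq hK hu.1).add (hasSum_expTerm hq0 hq hK hu.2)).mul_left
    (Real.pi / (ellK k * k) : ℂ)
  have hK' : (ellK k : ℂ) ≠ 0 := by exact_mod_cast hK
  have hpi : (Real.pi : ℂ) ≠ 0 := by exact_mod_cast Real.pi_ne_zero
  have e : -(k : ℂ)⁻¹ * (nomeLogDeriv q k u + nomeLogDeriv q k (-u)) =
      Real.pi / (ellK k * k) * (-(ellK k / Real.pi) * nomeLogDeriv q k u +
        -(ellK k / Real.pi) * nomeLogDeriv q k (-u)) := by
    field_simp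
    ring
  rw [e]
  exact h.congr_fun fun n => cdTerm_eq q k n u

theorem hasSum_cd1Term {q : ℝ} (hq0 : 0 < q) (hq : q < 1) {k : ℝ} (hK : ellK k ≠ 0) {u s : ℂ}
    (hu : u ∈ strip q k) (hs : HasSum (fun n => cdTerm q k n u) s) :
    HasSum (fun n => cd1Term q k n u)
      (s * Complex.cos (Real.pi * u / ellK k) - Complex.I * s * Complex.sin (Real.pi * u / ellK k)
        - 2 * Complex.I * (k : ℂ)⁻¹ * Complex.sin (Real.pi * u / ellK k) *
          nomeLogDeriv q k u) := by
  have h := ((hs.mul_right (Complex.cos (Real.pi * u / ellK k))).sub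
    ((hs.mul_left Complex.I).mul_right (Complex.sin (Real.pi * u / ellK k)))).add
    ((hasSum_expTerm hq0 hq hK hu.1).mul_left
      (Complex.I * (2 * Real.pi / (ellK k * k)) * Complex.sin (Real.pi * u / ellK k)))
  have hK' : (ellK k : ℂ) ≠ 0 := by exact_mod_cast hK
  have hpi : (Real.pi : ℂ) ≠ 0 := by exact_mod_cast Real.pi_ne_zero
  have e : Complex.I * (2 * Real.pi / (ellK k * k)) * Complex.sin (Real.pi * u / ellK k) *
      (-(ellK k / Real.pi) * nomeLogDeriv q k u) =
      -(2 * Complex.I * (k : ℂ)⁻¹ * Complex.sin (Real.pi * u / ellK k) *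
        nomeLogDeriv q k u) := by
    generalize Complex.sin (Real.pi * u / ellK k) = S
    field_simp
  rw [e, ← sub_eq_add_neg] at h
  exact h.congr_fun fun n => cd1Term_eq q k n u

theorem isContinuation_cd {q : ℝ} (hq0 : 0 < q) (hq : q < 1) {k : ℝ} (hK : ellK k ≠ 0) :
    IsContinuationOfSeries (cdTerm q k) (strip q k) Set.univ (cd q k) := by
  refine isContinuationOfSeries_continuationOfSeries ⟨_, isContinuationOfSeries_toMeromorphicNFOn
    (g := fun u => -(k : ℂ)⁻¹ * (nomeLogDeriv q k u + nomeLogDeriv q k (-u)))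
    (fun u _ => ?_) (Set.subset_univ _) (fun u hu => ?_) fun u hu => hasSum_cdTerm hq0 hq hK hu⟩
  · have h2 : MeromorphicAt (fun u => nomeLogDeriv q k (-u)) u :=
      (meromorphicAt_nomeLogDeriv hq0 hq k (-u)).comp_analyticAt (by fun_prop)
    exact (MeromorphicAt.const _ u).mul ((meromorphicAt_nomeLogDeriv hq0 hq k u).add h2)
  · have h2 : AnalyticAt ℂ (fun u => nomeLogDeriv q k (-u)) u :=
      (analyticAt_nomeLogDeriv hq0 hq hu.2).fun_comp (f := fun u => -u) (by fun_prop)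
    exact analyticAt_const.mul ((analyticAt_nomeLogDeriv hq0 hq hu.1).add h2)

/-- The right-hand side of the formula that expresses `cd₁` through `cd` and the logarithmic
derivative of `(-A; q)_∞ / (A; q)_∞`. -/
def cd1Formula (q k : ℝ) (u : ℂ) : ℂ :=
  cd q k u * Complex.cos (Real.pi * u / ellK k)
    - Complex.I * cd q k u * Complex.sin (Real.pi * u / ellK k)
    - 2 * Complex.I * (k : ℂ)⁻¹ * Complex.sin (Real.pi * u / ellK k) * nomeLogDeriv q k u

theorem analyticAt_cd1Formula {q : ℝ} (hq0 : 0 < q) (hq : q < 1) {k : ℝ} {u : ℂ}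
    (hu : u ∈ halfPlane q k) (h : AnalyticAt ℂ (cd q k) u) : AnalyticAt ℂ (cd1Formula q k) u := by
  have hL := analyticAt_nomeLogDeriv hq0 hq hu
  unfold cd1Formula
  fun_prop

theorem meromorphicOn_cd1Formula {q : ℝ} (hq0 : 0 < q) (hq : q < 1) {k : ℝ}
    (hK : ellK k ≠ 0) : MeromorphicOn (cd1Formula q k) (halfPlane q k) := by
  intro u _
  have hL := meromorphicAt_nomeLogDeriv hq0 hq k u
  have hcd := (isContinuation_cd hq0 hq hK).1.meromorphicOn u trivial
  unfold cd1Formula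
  fun_prop

/-- `cd` is a chosen continuation, but on the open strip uniqueness of sums identifies it with the
explicit analytic function. -/
theorem analyticAt_cd {q : ℝ} (hq0 : 0 < q) (hq : q < 1) {k : ℝ} (hK : ellK k ≠ 0) {u : ℂ}
    (hu : u ∈ strip q k) : AnalyticAt ℂ (cd q k) u := by
  have hc := isContinuation_cd hq0 hq hK
  have h2 : AnalyticAt ℂ (fun u => nomeLogDeriv q k (-u)) u :=
    (analyticAt_nomeLogDeriv hq0 hq hu.2).fun_comp (f := fun u => -u) (by fun_prop)
  refine AnalyticAt.congr
    (analyticAt_const.mul ((analyticAt_nomeLogDeriv hq0 hq hu.1).add h2) :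
      AnalyticAt ℂ (fun u => -(k : ℂ)⁻¹ * (nomeLogDeriv q k u + nomeLogDeriv q k (-u))) u) ?_
  filter_upwards [(isOpen_strip q k).mem_nhds hu] with v hv
  exact (hasSum_cdTerm hq0 hq hK hv).unique (hc.2 v hv)

theorem isContinuation_cd1 {q : ℝ} (hq0 : 0 < q) (hq : q < 1) {k : ℝ} (hK : ellK k ≠ 0) :
    IsContinuationOfSeries (cd1Term q k) (strip q k) (halfPlane q k) (cd1 q k) :=
  isContinuationOfSeries_continuationOfSeries ⟨_, isContinuationOfSeries_toMeromorphicNFOn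
    (meromorphicOn_cd1Formula hq0 hq hK) (fun _ hu => hu.1)
    (fun _ hu => analyticAt_cd1Formula hq0 hq hu.1 (analyticAt_cd hq0 hq hK hu))
    fun u hu => hasSum_cd1Term hq0 hq hK hu ((isContinuation_cd hq0 hq hK).2 u hu)⟩

/-- The identity theorem gives equality on a punctured neighbourhood; since both sides are in normal
form at `u`, it extends to `u`. -/
theorem cd1_eventuallyEq {q : ℝ} (hq0 : 0 < q) (hq : q < 1) {k : ℝ} (hK : ellK k ≠ 0) {u : ℂ}
    (hu : u ∈ halfPlane q k) (h : AnalyticAt ℂ (cd q k) u) :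
    cd1 q k =ᶠ[𝓝 u] cd1Formula q k := by
  have hc1 := isContinuation_cd1 hq0 hq hK
  rw [← (hc1.1 hu).eventuallyEq_nhdsNE_iff_eventuallyEq_nhds
    (analyticAt_cd1Formula hq0 hq hu h).meromorphicNFAt]
  refine eventuallyEq_nhdsNE_of_eqOn hc1.1.meromorphicOn (meromorphicOn_cd1Formula hq0 hq hK)
    (convex_halfPlane hq0 k).isPreconnected (isOpen_strip q k) (fun _ hv => hv.1)
    ⟨0, zero_mem_strip hq k⟩ (fun v hv => ?_) hu
  exact (hc1.2 v hv).unique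
    (hasSum_cd1Term hq0 hq hK hv ((isContinuation_cd hq0 hq hK).2 v hv))

end EllipticCd

end

/-! ### The two formulas for `cd₁` -/

open EllipticCd in
theorem theorem16 (r q k : ℝ) (hr : 0 < r) (hq : q = Real.exp (-Real.pi * √r))
    (hk : IsSingularModulus r k) :
    -- the series converge on the strip and continue meromorphically
    IsContinuationOfSeries (cdTerm q k) (strip q k) Set.univ (cd q k) ∧
    IsContinuationOfSeries (cd1Term q k) (strip q k) (halfPlane q k) (cd1 q k) ∧
    -- the functions under the logarithm exist, are holomorphic and have no zeros
    (∀ t ∈ halfPlane q k,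
      CFConvergesTo (ramanujanCF q (nomeA q k t)) (cfValue q (nomeA q k t)) ∧
      cfValue q (nomeA q k t) ≠ 0 ∧
      DifferentiableAt ℂ (fun s => cfValue q (nomeA q k s)) t ∧
      qPoch (nomeA q k t) q ≠ 0 ∧
      qPochQuot q (nomeA q k t) ≠ 0 ∧
      DifferentiableAt ℂ (fun s => qPochQuot q (nomeA q k s)) t) ∧
    -- the two formulas
    ∀ u ∈ halfPlane q k, AnalyticAt ℂ (cd q k) u →
      AnalyticAt ℂ (cd1 q k) u ∧
      cd1 q k u =
        cd q k u * Complex.cos (Real.pi * u / ellK k)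
          - Complex.I * cd q k u * Complex.sin (Real.pi * u / ellK k)
          - Complex.I * (k : ℂ)⁻¹ * Complex.sin (Real.pi * u / ellK k) *
            logDeriv (fun t => cfValue q (nomeA q k t)) u ∧
      cd1 q k u =
        cd q k u * Complex.cos (Real.pi * u / ellK k)
          - Complex.I * cd q k u * Complex.sin (Real.pi * u / ellK k)
          - 2 * Complex.I * (k : ℂ)⁻¹ * Complex.sin (Real.pi * u / ellK k) *
            logDeriv (fun t => qPochQuot q (nomeA q k t)) u := by
  have hq0 : 0 < q := hq ▸ Real.exp_pos _
  have hq1 : q < 1 := by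
    rw [hq, Real.exp_lt_one_iff]
    have := mul_pos Real.pi_pos (Real.sqrt_pos.2 hr)
    linarith
  -- If `K(k)` were `0`, the quotient in the modulus equation would take the default value `0`, but
  -- `√r > 0`.
  have hK : ellK k ≠ 0 := fun h => by
    have h2 := hk.2.2
    rw [h, div_zero] at h2
    exact (Real.sqrt_pos.2 hr).ne h2
  have hqc := norm_ofReal_lt_one hq0 hq1
  have hA := differentiable_nomeA q k
  have hval : ∀ t ∈ halfPlane q k,
      cfValue q (nomeA q k t) = qPochQuot q (nomeA q k t) ^ 2 := fun t ht =>
    cfValue_eq hqc (mem_halfPlane_iff.1 ht)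
  have hev : ∀ t ∈ halfPlane q k, (fun s => cfValue q (nomeA q k s)) =ᶠ[𝓝 t]
      fun s => qPochQuot q (nomeA q k s) ^ 2 := fun t ht =>
    eventually_of_mem ((isOpen_halfPlane q k).mem_nhds ht) hval
  have hdiff : ∀ t ∈ halfPlane q k,
      DifferentiableAt ℂ (fun s => qPochQuot q (nomeA q k s)) t := fun t ht =>
    (differentiableAt_qPochQuot hqc (mem_halfPlane_iff.1 ht)).comp t (hA t)
  refine ⟨isContinuation_cd hq0 hq1 hK, isContinuation_cd1 hq0 hq1 hK, fun t ht => ?_,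
    fun u hu h => ?_⟩
  · have ht' := mem_halfPlane_iff.1 ht
    have hne := qPochQuot_ne_zero hqc ht'
    refine ⟨?_, ?_, ?_, qPoch_ne_zero hqc ht', hne, hdiff t ht⟩
    · rw [hval t ht]
      exact ramanujanCF_convergesTo hqc ht'
    · rw [hval t ht]
      exact pow_ne_zero 2 hne
    · exact ((hdiff t ht).pow 2).congr_of_eventuallyEq (hev t ht)
  · have he := cd1_eventuallyEq hq0 hq1 hK hu h
    -- `F = Q(A)²` near `u`, so its logarithmic derivative is twice that of `Q(A)`; this accounts
    -- for the missing `2` in the first formula.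
    have hlog : logDeriv (fun t => cfValue q (nomeA q k t)) u = 2 * nomeLogDeriv q k u := by
      rw [(logDeriv_congr_nhds (hev u hu)).eq_of_nhds, logDeriv_fun_pow (hdiff u hu), nomeLogDeriv]
      norm_num
    refine ⟨(analyticAt_cd1Formula hq0 hq1 hu h).congr he.symm, ?_, he.eq_of_nhds⟩
    rw [hlog, he.eq_of_nhds, cd1Formula]
    ring
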